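/- Let $r \ge 1$ be an integer and let $0 < \varepsilon < \frac{1}{20 r^2}$. Then there is a constant $c_0 = c_0(r,\varepsilon)$, depending only on $r$ and $\varepsilon$, such that for all distinct primes $p_1,\dots,p_r \ge c_0$ there are infinitely many positive integers $n$ for which $$\nu_{p_i}\!\left(\binom{2n}{n}\right) \;\le\; \frac{\varepsilon \log n}{\log p_i} \qquad \text{for all } i = 1,\dots,r,$$ where $\nu_p(x)$ denotes the number of times the prime $p$ divides $x$. -/

import Mathlib

/-! By Legendre's formula, `ν_p (2n choose n)` counts the `j ≥ 1` with `2 (n mod p ^ j) ≥ p ^ j`.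
Let `T` be the set of those powers `P ≤ N` of the given primes for which no power `Q` of any of
these primes satisfies `P < Q < 3 P`. Any two elements of `T` differ by a factor of at least `3`,
so a descending chain of nested intervals gives an `n` with `N ≤ n < 5 N / 2` and
`2 (n mod P) < P` for every `P ∈ T` (`exists_forall_two_mul_mod_lt`). For this `n` the exponent
`j` contributes to `ν_p` only if `p ^ j > N`, which leaves a single `j`, or if a power of another
prime `q` of the list lies in `(p ^ j, 3 p ^ j)`.

The latter condition says that `j * (log p / log q)`, modulo `1`, lies in a fixed arc of length
`l = log 3 / log q`. As `p ^ a = q ^ b` has no nontrivial solution, some multiple `s` of the angle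
`log p / log q` is a rotation by an amount in `[l, 2 l)`, and then at most one of
`j, j + s, …, j + (K - 1) s` satisfies the condition, as soon as `(2 K - 1) l ≤ 1`
(`not_closePower_add_mul`). Hence the exceptional `j` have density at most `1 / K`
(`exists_count_closePower_le`), and `K ≥ 2 r / ε` suffices, which is possible once all primes are
at least `3 ^ (2 K)`. -/

/-- The exponent `a` is close for the pair `(p, q)` if a power of `q` lies strictly between `p ^ a`
and `3 * p ^ a`. -/
def ClosePower (p q a : ℕ) : Prop := ∃ b : ℕ, p ^ a < q ^ b ∧ q ^ b < 3 * p ^ a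

/-! ### Integers with small residues modulo a lacunary set -/

/-- The length of the interval is `W / 2`; doubling avoids halves. The induction removes the largest
modulus `a`: some `[m * a, m * a + a / 2)` lies in the interval. -/
theorem exists_forall_two_mul_mod_lt (T : Finset ℕ) (hpos : ∀ P ∈ T, 0 < P)
    (hT : ∀ P ∈ T, ∀ Q ∈ T, P < Q → 3 * P ≤ Q) :
    ∀ u W : ℕ, 0 < W → (∀ P ∈ T, 3 * P ≤ W) →
      ∃ n, u ≤ n ∧ 2 * n < 2 * u + W ∧ ∀ P ∈ T, 2 * (n % P) < P := by
  induction T using Finset.induction_on_max with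
  | empty => exact fun u W hW _ => ⟨u, le_rfl, by omega, by simp⟩
  | insert a T ha ih =>
    intro u W hW hTW
    have ha0 : 0 < a := hpos a (Finset.mem_insert_self _ _)
    obtain ⟨n, hn1, hn2, hn3⟩ := ih (fun P hP => hpos P (Finset.mem_insert_of_mem hP))
      (fun P hP Q hQ => hT P (Finset.mem_insert_of_mem hP) Q (Finset.mem_insert_of_mem hQ))
      (a * ((u + (a - 1)) / a)) a ha0
      (fun P hP => hT P (Finset.mem_insert_of_mem hP) a (Finset.mem_insert_self _ _) (ha P hP))
    have h1 := Nat.div_add_mod (u + (a - 1)) a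
    have h2 := Nat.mod_lt (u + (a - 1)) ha0
    have h3 := hTW a (Finset.mem_insert_self _ _)
    set m := (u + (a - 1)) / a
    refine ⟨n, by omega, by omega, fun P hP => ?_⟩
    rcases Finset.mem_insert.1 hP with rfl | hP
    · obtain ⟨d, rfl⟩ := Nat.exists_eq_add_of_le hn1
      rw [Nat.mul_add_mod]
      have := Nat.mod_le d P
      omega
    · exact hn3 P hP

/-! ### Density of close exponents -/

/-- In an initial segment of length at most `K * s`, each residue class modulo `s` contains at most
one element of `S`. -/
theorem count_le_of_not_add_mul (S : ℕ → Prop) [DecidablePred S] {s K : ℕ} (hs : 0 < s)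
    (h : ∀ a m, S a → 1 ≤ m → m < K → ¬ S (a + m * s)) {A : ℕ} (hA : A ≤ K * s) :
    Nat.count S A ≤ s := by
  rw [Nat.count_eq_card_filter_range]
  calc _ ≤ (Finset.range s).card := by
        refine Finset.card_le_card_of_injOn (· % s) ?_ ?_
        · intro a _
          simpa using Nat.mod_lt a hs
        · have key : ∀ a b, S a → S b → b < A → a % s = b % s → ¬ a < b := by
            intro a b ha hb hbA hab hlt
            obtain ⟨m, hm⟩ := (Nat.modEq_iff_dvd' hlt.le).1 hab
            have hb' : b = a + m * s := by
              rw [mul_comm m, ← hm]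
              omega
            refine h a m ha ?_ ?_ (hb' ▸ hb)
            · rcases Nat.eq_zero_or_pos m with rfl | h0
              · simp at hb'
                omega
              · exact h0
            · by_contra! hm
              have := Nat.mul_le_mul_right s hm
              omega
          intro a ha b hb hab
          simp only [Finset.coe_filter, Finset.mem_range, Set.mem_ofPred_eq] at ha hb
          exact le_antisymm (not_lt.1 (key b a hb.2 ha.2 ha.1 hab.symm))
            (not_lt.1 (key a b ha.2 hb.2 hb.1 hab))
    _ = s := Finset.card_range s

theorem mul_count_le_of_not_add_mul {s K : ℕ} (hs : 0 < s) (hK : 0 < K) (A : ℕ) :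
    ∀ (S : ℕ → Prop) [DecidablePred S],
      (∀ a m, S a → 1 ≤ m → m < K → ¬ S (a + m * s)) → K * Nat.count S A ≤ A + K * s := by
  induction A using Nat.strong_induction_on with
  | _ A ih =>
    intro S _ h
    rcases le_total A (K * s) with hA | hA
    · have := Nat.mul_le_mul_left K (count_le_of_not_add_mul S hs h hA)
      omega
    · obtain ⟨A', rfl⟩ := Nat.exists_eq_add_of_le hA
      have h0 : 0 < K * s := Nat.mul_pos hK hs
      have h1 := ih A' (by omega) (fun k => S (K * s + k))
        (fun a m ha h1 h2 => by simpa only [add_assoc] using h (K * s + a) m ha h1 h2)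
      have h2 := Nat.mul_le_mul_left K (count_le_of_not_add_mul S hs h (le_refl (K * s)))
      rw [Nat.count_add, mul_add]
      omega

/-- A rotation by `γ` that is not too close to being rational has an iterate whose displacement is
comparable to a prescribed length `l`: take a smaller nonzero displacement from Dirichlet's theorem
and iterate it until it first reaches `l`. -/
theorem exists_iterate_abs_sub_mem {γ l : ℝ} (hl : 0 < l)
    (hγ : ∀ (s : ℕ) (c : ℤ), 0 < s → (s : ℝ) * γ ≠ c) :
    ∃ (s : ℕ) (c : ℤ), 0 < s ∧ l ≤ |(s : ℝ) * γ - c| ∧ |(s : ℝ) * γ - c| < 2 * l := by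
  obtain ⟨M, hM⟩ := exists_nat_gt (1 / l)
  have hM0 : 0 < M := by
    have : (0 : ℝ) < M := lt_trans (by positivity) hM
    exact_mod_cast this
  obtain ⟨j, k, hk0, hkM, hjk⟩ := Real.exists_int_int_abs_mul_sub_le γ hM0
  lift k to ℕ using hk0.le
  have hk0' : 0 < k := by exact_mod_cast hk0
  simp only [Int.cast_natCast] at hjk
  have hd0 : 0 < |(k : ℝ) * γ - j| := abs_pos.2 (sub_ne_zero.2 (hγ k j hk0'))
  have hdl : |(k : ℝ) * γ - j| < l := by
    refine hjk.trans_lt ?_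
    rw [div_lt_iff₀ (by positivity)]
    rw [div_lt_iff₀ hl] at hM
    nlinarith
  set d := |(k : ℝ) * γ - j| with hd
  have hh : 0 < ⌈l / d⌉₊ := Nat.ceil_pos.2 (by positivity)
  have h1 := Nat.le_ceil (l / d)
  have h2 := Nat.ceil_lt_add_one (show 0 ≤ l / d by positivity)
  set h := ⌈l / d⌉₊
  have habs : |((h * k : ℕ) : ℝ) * γ - ((h * j : ℤ) : ℝ)| = h * d := by
    have hsub : ((h * k : ℕ) : ℝ) * γ - ((h * j : ℤ) : ℝ) = h * ((k : ℝ) * γ - j) := by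
      push_cast
      ring
    rw [hsub, abs_mul, Nat.abs_cast]
  refine ⟨h * k, h * j, Nat.mul_pos hh hk0', ?_, ?_⟩
  · rw [habs]
    rwa [div_le_iff₀ hd0] at h1
  · rw [habs]
    have h3 : (h : ℝ) * d < (l / d + 1) * d := by gcongr
    rw [add_mul, div_mul_cancel₀ _ hd0.ne'] at h3
    linarith

theorem ClosePower.exists_sub_mem {p q a : ℕ} (hp : 0 < p) (hq : 1 < q) (h : ClosePower p q a) :
    ∃ b : ℤ, 0 < (b : ℝ) - a * (Real.log p / Real.log q) ∧
      (b : ℝ) - a * (Real.log p / Real.log q) < Real.log 3 / Real.log q := by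
  obtain ⟨b, h1, h2⟩ := h
  have hlq : 0 < Real.log q := Real.log_pos (by exact_mod_cast hq)
  have hp' : (0 : ℝ) < p := by exact_mod_cast hp
  have h1' : Real.log ((p : ℝ) ^ a) < Real.log ((q : ℝ) ^ b) :=
    Real.log_lt_log (by positivity) (by exact_mod_cast h1)
  have h2' : Real.log ((q : ℝ) ^ b) < Real.log (3 * (p : ℝ) ^ a) :=
    Real.log_lt_log (by positivity) (by exact_mod_cast h2)
  rw [Real.log_mul (by norm_num) (by positivity)] at h2'
  rw [Real.log_pow, Real.log_pow] at h1' h2'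
  have e : (b : ℝ) - a * (Real.log p / Real.log q)
      = (b * Real.log q - a * Real.log p) / Real.log q := by field_simp
  refine ⟨b, ?_, ?_⟩
  · rw [Int.cast_natCast, e]
    exact div_pos (by linarith) hlq
  · rw [Int.cast_natCast, e]
    exact div_lt_div_of_pos_right (by linarith) hlq

theorem not_closePower_add_mul {p q K s : ℕ} {c : ℤ} (hp : 0 < p) (hq : 1 < q)
    (hK : (2 * K - 1) * (Real.log 3 / Real.log q) ≤ 1)
    (hs1 : Real.log 3 / Real.log q ≤ |(s : ℝ) * (Real.log p / Real.log q) - c|)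
    (hs2 : |(s : ℝ) * (Real.log p / Real.log q) - c| < 2 * (Real.log 3 / Real.log q))
    (a m : ℕ) (ha : ClosePower p q a) (hm : 1 ≤ m) (hmK : m < K) :
    ¬ ClosePower p q (a + m * s) := by
  intro ha'
  obtain ⟨b, hb1, hb2⟩ := ha.exists_sub_mem hp hq
  obtain ⟨b', hb1', hb2'⟩ := ha'.exists_sub_mem hp hq
  set γ := Real.log p / Real.log q
  set l := Real.log 3 / Real.log q
  set τ := (s : ℝ) * γ - c with hτ
  have hl : 0 < l := by linarith
  have hm' : (1 : ℝ) ≤ m := by exact_mod_cast hm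
  have hmK' : (m : ℝ) + 1 ≤ K := by exact_mod_cast hmK
  -- The integer `e` is within `l` of `m * τ`, whereas `l ≤ |m * τ| ≤ 1 - l`.
  obtain ⟨e, he⟩ : ∃ e : ℤ, e = b' - b - m * c := ⟨_, rfl⟩
  have he' : (e : ℝ) - m * τ = (b' - (a + m * s : ℕ) * γ) - (b - a * γ) := by
    rw [he, hτ]
    push_cast
    ring
  have hlt : |(e : ℝ) - m * τ| < l := by
    rw [he', abs_lt]
    constructor <;> linarith
  have hmτ : |(m : ℝ) * τ| = m * |τ| := by rw [abs_mul, Nat.abs_cast]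
  rcases eq_or_ne e 0 with h0 | h0
  · rw [h0, Int.cast_zero, zero_sub, abs_neg, hmτ] at hlt
    nlinarith
  · have h1 : (1 : ℝ) ≤ |(e : ℝ)| := by exact_mod_cast Int.one_le_abs h0
    have h2 : |(e : ℝ)| ≤ |(e : ℝ) - m * τ| + |(m : ℝ) * τ| := by
      simpa using abs_add_le ((e : ℝ) - m * τ) (m * τ)
    rw [hmτ] at h2
    have h3 : (m : ℝ) * |τ| ≤ (K - 1) * (2 * l) := by
      exact mul_le_mul (by linarith) hs2.le (abs_nonneg _) (by linarith)
    nlinarith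

/-- The exponents `a` that are close for `(p, q)` have upper density at most `1 / K`. -/
theorem exists_count_closePower_le {p q K : ℕ} (hp : p.Prime) (hq : q.Prime) (hK : 0 < K)
    (hp3 : 3 ≤ p) (hqK : 3 ^ (2 * K) ≤ q) [DecidablePred (ClosePower p q)] :
    ∃ C : ℕ, ∀ A : ℕ, K * Nat.count (ClosePower p q) A ≤ A + C := by
  rcases eq_or_ne p q with rfl | hpq
  · refine ⟨0, fun A => ?_⟩
    have : ∀ a, ¬ ClosePower p p a := by
      rintro a ⟨b, h1, h2⟩
      have hab : a + 1 ≤ b := (Nat.pow_lt_pow_iff_right hp.one_lt).1 h1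
      have h3 := Nat.pow_le_pow_right hp.pos hab
      have h4 := Nat.mul_le_mul_right (p ^ a) hp3
      rw [pow_succ'] at h3
      omega
    rw [Nat.count_eq_card_filter_range, Finset.filter_false_of_mem (fun a _ => this a)]
    simp
  · have hlq : 0 < Real.log q := Real.log_pos (by exact_mod_cast hq.one_lt)
    have hl : 0 < Real.log 3 / Real.log q := div_pos (Real.log_pos (by norm_num)) hlq
    have hγ : ∀ (s : ℕ) (c : ℤ), 0 < s → (s : ℝ) * (Real.log p / Real.log q) ≠ c := by
      intro s c hs h
      have hlp : 0 < Real.log p := Real.log_pos (by exact_mod_cast hp.one_lt)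
      have hc : 0 ≤ c := by
        have : (0 : ℝ) ≤ c := h ▸ by positivity
        exact_mod_cast this
      lift c to ℕ using hc
      rw [Int.cast_natCast, ← mul_div_assoc, div_eq_iff hlq.ne', ← Real.log_pow,
        ← Real.log_pow] at h
      have hp0 : (0 : ℝ) < p := by exact_mod_cast hp.pos
      have hq0 : (0 : ℝ) < q := by exact_mod_cast hq.pos
      have h' : p ^ s = q ^ c := by
        exact_mod_cast Real.log_injOn_pos (Set.mem_Ioi.2 (by positivity))
          (Set.mem_Ioi.2 (by positivity)) h
      have hd : p ∣ q ^ c := h' ▸ dvd_pow_self p hs.ne'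
      exact hpq ((Nat.prime_dvd_prime_iff_eq hp hq).1 (hp.dvd_of_dvd_pow hd))
    obtain ⟨s, c, hs, h1, h2⟩ := exists_iterate_abs_sub_mem hl hγ
    have hKl : (2 * K - 1) * (Real.log 3 / Real.log q) ≤ 1 := by
      have h3 : Real.log ((3 : ℝ) ^ (2 * K)) ≤ Real.log q :=
        Real.log_le_log (by positivity) (by exact_mod_cast hqK)
      rw [Real.log_pow] at h3
      push_cast at h3
      have h4 : 0 < Real.log 3 := Real.log_pos (by norm_num)
      rw [← mul_div_assoc, div_le_one hlq]
      linarith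
    exact ⟨K * s, fun A => mul_count_le_of_not_add_mul hs hK A _
      (not_closePower_add_mul hp.pos hq.one_lt hKl h1 h2)⟩

/-! ### Central binomial coefficients -/

open Classical in
/-- If `n` is slightly larger than `N` and has small residues modulo all powers `P ≤ N` of `p i`
with no power of a `p k` in `(P, 3 P)`, then `ν_{p i} (2n choose n)` is at most the number of
close exponents, plus one for the unique power of `p i` in `(N, 2 n]`. -/
theorem padicValNat_choose_le_sum_count {ι : Type*} [Fintype ι] (p : ι → ℕ) (i : ι)
    (hp : (p i).Prime) (hp5 : 5 ≤ p i) {N n : ℕ} (hN : 0 < N) (hn : 2 * n < 5 * N)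
    (h : ∀ a, 1 ≤ a → p i ^ a ≤ N → (∀ k, ¬ ClosePower (p i) (p k) a) →
      2 * (n % p i ^ a) < p i ^ a) :
    padicValNat (p i) (Nat.choose (2 * n) n) ≤
      (∑ k, Nat.count (ClosePower (p i) (p k)) (Nat.log (p i) N + 1)) + 1 := by
  have := Fact.mk hp
  rw [padicValNat_choose (by omega : n ≤ 2 * n) (Nat.lt_succ_self _)]
  calc _ ≤ ((Finset.univ.biUnion fun k => (Finset.range (Nat.log (p i) N + 1)).filter
          (ClosePower (p i) (p k))) ∪ {Nat.log (p i) N + 1}).card := by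
        refine Finset.card_le_card fun a ha => ?_
        simp only [Finset.mem_filter, Finset.mem_Ico] at ha
        obtain ⟨⟨ha1, ha2⟩, ha3⟩ := ha
        rw [show 2 * n - n = n by omega, ← two_mul] at ha3
        have hlog : a ≤ Nat.log (p i) N + 1 := by
          by_contra! hlt
          have hn0 : n ≠ 0 := by
            rintro rfl
            have := Nat.pow_pos (n := a) hp.pos
            simp at ha3
            omega
          have h1 : p i ^ a ≤ 2 * n := Nat.pow_le_of_le_log (by omega) (by omega)
          have h2 : p i ^ (Nat.log (p i) N + 1 + 1) ≤ p i ^ a := Nat.pow_le_pow_right hp.pos hlt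
          have h3 := Nat.lt_pow_succ_log_self hp.one_lt N
          rw [pow_succ'] at h2
          have h4 := Nat.mul_le_mul hp5 h3.le
          rw [Nat.succ_eq_add_one] at h4
          omega
        rw [Finset.mem_union, Finset.mem_singleton]
        rcases hlog.lt_or_eq with hlt | rfl
        · left
          have haN : p i ^ a ≤ N := Nat.pow_le_of_le_log hN.ne' (by omega)
          by_contra hcon
          have := h a ha1 haN fun k hk => hcon (Finset.mem_biUnion.2
            ⟨k, Finset.mem_univ _, Finset.mem_filter.2 ⟨Finset.mem_range.2 hlt, hk⟩⟩)
          omega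
        · exact Or.inr rfl
    _ ≤ _ := by
        refine (Finset.card_union_le _ _).trans ?_
        rw [Finset.card_singleton]
        gcongr
        refine Finset.card_biUnion_le.trans (le_of_eq ?_)
        simp only [Nat.count_eq_card_filter_range]

/-- Applies `exists_forall_two_mul_mod_lt` to the powers `P ≤ N` of the `p i` that have no other
such power in `(P, 3 P)`. -/
theorem exists_mod_small_of_not_closePower {ι : Type*} [Finite ι] (p : ι → ℕ)
    (hp : ∀ i, 1 < p i) {N : ℕ} (hN : 0 < N) :
    ∃ n, N ≤ n ∧ 2 * n < 5 * N ∧ ∀ i a, p i ^ a ≤ N →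
      (∀ k, ¬ ClosePower (p i) (p k) a) → 2 * (n % p i ^ a) < p i ^ a := by
  classical
  let T : Finset ℕ := (Finset.range (N + 1)).filter fun P =>
    ∃ i a, P = p i ^ a ∧ ∀ k, ¬ ClosePower (p i) (p k) a
  have hT : ∀ P, P ∈ T ↔ P ≤ N ∧ ∃ i a, P = p i ^ a ∧ ∀ k, ¬ ClosePower (p i) (p k) a := by
    intro P
    simp [T]
  obtain ⟨n, h1, h2, h3⟩ := exists_forall_two_mul_mod_lt T
    (by
      intro P hP
      obtain ⟨_, i, a, rfl, _⟩ := (hT P).1 hP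
      exact Nat.pow_pos (by have := hp i; omega))
    (by
      intro P hP Q hQ hPQ
      obtain ⟨_, i, a, rfl, hi⟩ := (hT P).1 hP
      obtain ⟨_, k, b, rfl, _⟩ := (hT Q).1 hQ
      by_contra! hlt
      exact hi k ⟨b, hPQ, hlt⟩)
    N (3 * N) (by omega) (fun P hP => by have := ((hT P).1 hP).1; omega)
  exact ⟨n, h1, by omega, fun i a ha hk => h3 _ ((hT _).2 ⟨ha, i, a, rfl, hk⟩)⟩

theorem theorem1 (r : ℕ) (hr : 1 ≤ r) (ε : ℝ) (hε : 0 < ε) (hε' : ε < 1 / (20 * (r : ℝ) ^ 2)) :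
    ∃ c₀ : ℝ, ∀ p : Fin r → ℕ, (∀ i, (p i).Prime) → Function.Injective p →
      (∀ i, c₀ ≤ (p i : ℝ)) →
      {n : ℕ | ∀ i, (padicValNat (p i) (Nat.choose (2 * n) n) : ℝ) ≤
        ε * Real.log (n : ℝ) / Real.log (p i : ℝ)}.Infinite := by
  classical
  obtain ⟨K, hK⟩ := exists_nat_gt (2 * (r : ℝ) / ε)
  have hK0' : (0 : ℝ) < K := lt_of_le_of_lt (by positivity) hK
  have hK0 : 0 < K := by exact_mod_cast hK0'
  rw [div_lt_iff₀ hε] at hK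
  refine ⟨((3 ^ (2 * K) : ℕ) : ℝ), fun p hp _ hc => ?_⟩
  have hc' : ∀ i, 3 ^ (2 * K) ≤ p i := fun i => by exact_mod_cast hc i
  have h9 : 9 ≤ 3 ^ (2 * K) := by
    calc 9 = 3 ^ 2 := by norm_num
      _ ≤ 3 ^ (2 * K) := Nat.pow_le_pow_right (by norm_num) (by omega)
  choose C hC using fun i k => exists_count_closePower_le (hp i) (hp k) hK0
    (by have := hc' i; omega) (hc' k)
  rw [Set.infinite_iff_exists_gt]
  intro n₀
  -- The bound needed for `p i` holds once `log N / log (p i)` is at least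
  -- `B i = 2 / ε * (∑ k, (1 + C i k) / K + 1)`.
  let B : Fin r → ℝ := fun i => 2 / ε * (∑ k, (1 + (C i k : ℝ)) / K + 1)
  obtain ⟨N, hN0, hNB⟩ : ∃ N : ℕ, n₀ < N ∧ ∀ i, B i ≤ Real.log N / Real.log (p i) := by
    have hlim : ∀ i, ∀ᶠ N : ℕ in Filter.atTop, B i ≤ Real.log N / Real.log (p i) := by
      intro i
      have hlp : 0 < Real.log (p i) := Real.log_pos (by exact_mod_cast (hp i).one_lt)
      exact ((Real.tendsto_log_atTop.comp tendsto_natCast_atTop_atTop).atTop_div_const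
        hlp).eventually_ge_atTop (B i)
    exact ((Filter.eventually_gt_atTop n₀).and (Filter.eventually_all.2 hlim)).exists
  have hNpos : 0 < N := by omega
  obtain ⟨n, hNn, hn, hmod⟩ := exists_mod_small_of_not_closePower p (fun i => (hp i).one_lt) hNpos
  refine ⟨n, fun i => ?_, by omega⟩
  have hlp : 0 < Real.log (p i) := Real.log_pos (by exact_mod_cast (hp i).one_lt)
  have hval := padicValNat_choose_le_sum_count p i (hp i) (by have := hc' i; omega) hNpos hn
    (fun a _ => hmod i a)
  have hval' : (padicValNat (p i) (Nat.choose (2 * n) n) : ℝ) ≤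
      (∑ k, (Nat.count (ClosePower (p i) (p k)) (Nat.log (p i) N + 1) : ℝ)) + 1 := by
    exact_mod_cast hval
  set L := Real.log N / Real.log (p i) with hL
  have hlog : (Nat.log (p i) N : ℝ) ≤ L := by
    rw [hL, le_div_iff₀ hlp, ← Real.log_pow]
    have hpos : (0 : ℝ) < p i := by exact_mod_cast (hp i).pos
    exact Real.log_le_log (by positivity) (by exact_mod_cast Nat.pow_log_le_self _ hNpos.ne')
  have hsum : (∑ k, (Nat.count (ClosePower (p i) (p k)) (Nat.log (p i) N + 1) : ℝ)) ≤
      ∑ k, (L / K + (1 + (C i k : ℝ)) / K) := by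
    refine Finset.sum_le_sum fun k _ => ?_
    rw [← add_div, le_div_iff₀ hK0', mul_comm]
    have h1 : (K : ℝ) * Nat.count (ClosePower (p i) (p k)) (Nat.log (p i) N + 1) ≤
        (Nat.log (p i) N + 1) + C i k := by exact_mod_cast hC i k (Nat.log (p i) N + 1)
    linarith
  rw [Finset.sum_add_distrib, Finset.sum_const, Finset.card_univ, Fintype.card_fin,
    nsmul_eq_mul] at hsum
  have hL0 : 0 ≤ L := div_nonneg (Real.log_natCast_nonneg N) hlp.le
  have hB : ∑ k, (1 + (C i k : ℝ)) / K + 1 ≤ ε / 2 * L := by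
    calc _ = ε / 2 * B i := by simp only [B]; field_simp
      _ ≤ ε / 2 * L := by gcongr; exact hNB i
  have hrK : (r : ℝ) * (L / K) ≤ ε / 2 * L := by
    rw [mul_div_assoc', div_le_iff₀ hK0']
    nlinarith
  calc _ ≤ ε * L := by linarith
    _ ≤ ε * (Real.log n / Real.log (p i)) := by
        have hN' : (0 : ℝ) < N := by exact_mod_cast hNpos
        rw [hL]
        gcongr
    _ = _ := (mul_div_assoc _ _ _).symm
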